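/- **Theorem.** Let $B_n$ be the braid group on $n$ strings with Artin generators $\sigma_1,\dots,\sigma_{n-1}$, and let $lk:B_n\to\mathbb Z$ be the homomorphism with $lk(\sigma_i)=1$ for all $i$. For $\beta\in B_n$ let $\widehat\beta$ denote its closure, an oriented link in $S^3$. A *completing braid* for $\beta$ is a braid $\alpha\in B_n$ such that $\widehat{\alpha\beta}$ is a knot and $\widehat\alpha$ is a $k$-component unlink for some $1\le k\le n$. Let $I$ be a real-valued invariant of (isotopy classes of oriented) knots in $S^3$ such that for every knot $K$ and every diagram $D$ of $K$ $$1+w(D)-o(D)\;\le\; I(K)\;\le\; -1+w(D)+o(D),$$ where $w(D)$ is the number of positive minus the number of negative crossings of $D$, and $o(D)$ is the number of Seifert circles of $D$. Fix a completing braid $\alpha_\beta$ for every $\beta\in B_n$, define $\widehat I:B_n\to\mathbb R$ by $\widehat I(\beta)=I(\widehat{\alpha_\beta\beta})$, and suppose that $\widehat I$ is a quasi-morphism, i.e. $|\widehat I(\beta\gamma)-\widehat I(\beta)-\widehat I(\gamma)|\le C$ for some constant $C>0$ and all $\beta,\gamma\in B_n$. Then for every $\beta\in B_n$ the limit $$\widetilde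 I(\beta)=\lim_{p\to+\infty}\frac{\widehat I(\beta^p)}{p}$$ that defines the homogenization $\widetilde I$ of $\widehat I$ exists, and $\widetilde I(\beta)=lk(\beta)$; that is, $\widetilde I=lk$. -/

import Mathlib

open Filter Topology

/-! ## Oriented link diagrams

An oriented link diagram in the plane in general position with respect to the height function is
cut by horizontal lines into slices, each of which contains exactly one local minimum, local maximum
or crossing.  It is recorded as the list of its slices, read from the bottom to the top.  Every link
diagram is of this form after an isotopy of the plane.  A horizontal level is recorded as the list
of the directions of the strands that meet it, from left to right (`true` = upwards,
`false` = downwards). -/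

/-- The elementary pieces of an oriented diagram. -/
inductive Piece : Type
  /-- A local minimum; its left leg has direction `e`. -/
  | cup (e : Bool)
  /-- A local maximum; its left leg has direction `e`. -/
  | cap (e : Bool)
  /-- A crossing.  The strand from bottom left to top right has direction `a`, the strand from
  bottom right to top left has direction `b`.  The former is the overstrand iff `p = true`. -/
  | cross (a b p : Bool)

namespace Piece

/-- The directions of the strands at the bottom of a piece. -/
def dom : Piece → List Bool
  | cup _ => []
  | cap e => [e, !e]
  | cross a b _ => [a, b]

/-- The directions of the strands at the top of a piece. -/
def cod : Piece → List Bool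
  | cup e => [e, !e]
  | cap _ => []
  | cross a b _ => [b, a]

end Piece

/-- A slice: an elementary piece with vertical strands to its left and to its right. -/
structure Slice where
  left : List Bool
  piece : Piece
  right : List Bool

namespace Slice

/-- The directions of the strands at the bottom of a slice. -/
def dom (x : Slice) : List Bool := x.left ++ x.piece.dom ++ x.right

/-- The directions of the strands at the top of a slice. -/
def cod (x : Slice) : List Bool := x.left ++ x.piece.cod ++ x.right

end Slice

/-- The slices in the list fit on top of each other, with bottom level `s` and top level `t`. -/
def IsTangle : List Bool → List Slice → List Bool → Prop
  | s, [], t => s = t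
  | s, x :: w, t => x.dom = s ∧ IsTangle x.cod w t

theorem IsTangle.append {s t u : List Bool} {v w : List Slice} (hv : IsTangle s v t)
    (hw : IsTangle t w u) : IsTangle s (v ++ w) u := by
  induction v generalizing s with
  | nil => cases hv; exact hw
  | cons x v ih => exact ⟨hv.1, ih hv.2⟩

/-- An oriented link diagram. -/
structure LinkDiagram where
  slices : List Slice
  closed : IsTangle [] slices []

/-! ### Components, writhe and Seifert circles -/

/-- `(k, j)` stands for the `j`-th point (from the left) of the diagram on the level directly below
the `k`-th slice. -/
def IsPoint (w : List Slice) (q : ℕ × ℕ) : Prop :=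
  ∃ x, w[q.1]? = some x ∧ q.2 < x.dom.length

/-- Two points are joined by an arc inside of a single slice. -/
inductive JoinedInSlice (w : List Slice) : ℕ × ℕ → ℕ × ℕ → Prop
  | left (k j : ℕ) (x : Slice) : w[k]? = some x → j < x.left.length →
      JoinedInSlice w (k, j) (k + 1, j)
  | right (k j : ℕ) (x : Slice) : w[k]? = some x → j < x.right.length →
      JoinedInSlice w (k, x.left.length + x.piece.dom.length + j)
        (k + 1, x.left.length + x.piece.cod.length + j)
  | cup (k : ℕ) (l r : List Bool) (e : Bool) : w[k]? = some ⟨l, .cup e, r⟩ →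
      JoinedInSlice w (k + 1, l.length) (k + 1, l.length + 1)
  | cap (k : ℕ) (l r : List Bool) (e : Bool) : w[k]? = some ⟨l, .cap e, r⟩ →
      JoinedInSlice w (k, l.length) (k, l.length + 1)
  | cross_right (k : ℕ) (l r : List Bool) (a b p : Bool) : w[k]? = some ⟨l, .cross a b p, r⟩ →
      JoinedInSlice w (k, l.length) (k + 1, l.length + 1)
  | cross_left (k : ℕ) (l r : List Bool) (a b p : Bool) : w[k]? = some ⟨l, .cross a b p, r⟩ →
      JoinedInSlice w (k, l.length + 1) (k + 1, l.length)

/-- The number of closed curves that make up a diagram: the classes of its points under the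
equivalence relation generated by being joined inside of a slice. -/
noncomputable def curveCount (w : List Slice) : ℕ :=
  Nat.card (Quot fun q r : {q : ℕ × ℕ // IsPoint w q} => JoinedInSlice w q.1 r.1)

/-- The sign of a crossing (and zero for the other pieces).  A crossing of two upward strands is
positive iff the strand from bottom left to top right is the overstrand, and reversing one of the
two strands changes the sign. -/
def Piece.sign : Piece → ℤ
  | .cross a b p => if (a == b) = p then 1 else -1
  | _ => 0

/-- The smoothing of a slice according to the orientation: two parallel strands become two vertical
strands, and two antiparallel ones become a local maximum below a local minimum. -/
def Slice.smooth : Slice → List Slice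
  | ⟨l, .cross a b _, r⟩ => if a = b then [] else [⟨l, .cap a, r⟩, ⟨l, .cup b, r⟩]
  | x => [x]

namespace LinkDiagram

/-- The number of components of the link. -/
noncomputable def componentCount (D : LinkDiagram) : ℕ := curveCount D.slices

/-- The writhe `w(D)`: the number of positive minus the number of negative crossings. -/
def writhe (D : LinkDiagram) : ℤ := (D.slices.map fun x => x.piece.sign).sum

/-- The number `o(D)` of Seifert circles: the number of closed curves after all crossings have been
smoothed. -/
noncomputable def seifertCount (D : LinkDiagram) : ℕ := curveCount (D.slices.flatMap Slice.smooth)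

end LinkDiagram

/-! ### Isotopy of links -/

/-- The local moves: isotopies of the plane (the first five) and Reidemeister moves. -/
inductive Move : List Slice → List Slice → Prop
  /-- Two distant pieces exchange their heights. -/
  | exchange (l m r : List Bool) (x y : Piece) :
      Move [⟨l, x, m ++ y.dom ++ r⟩, ⟨l ++ x.cod ++ m, y, r⟩]
        [⟨l ++ x.dom ++ m, y, r⟩, ⟨l, x, m ++ y.cod ++ r⟩]
  /-- A local minimum and a local maximum to the left of it cancel. -/
  | zigzag_left (l r : List Bool) (a : Bool) :
      Move [⟨l ++ [a], .cup (!a), r⟩, ⟨l, .cap a, a :: r⟩] []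
  /-- A local minimum and a local maximum to the right of it cancel. -/
  | zigzag_right (l r : List Bool) (a : Bool) :
      Move [⟨l, .cup a, a :: r⟩, ⟨l ++ [a], .cap (!a), r⟩] []
  /-- A local minimum passes through a crossing with a transversal strand. -/
  | slide_cup (l r : List Bool) (e c p : Bool) :
      Move [⟨l, .cup e, c :: r⟩, ⟨l ++ [e], .cross (!e) c p, r⟩]
        [⟨l ++ [c], .cup e, r⟩, ⟨l, .cross c e (!p), (!e) :: r⟩]
  /-- A local maximum passes through a crossing with a transversal strand. -/
  | slide_cap (l r : List Bool) (e c p : Bool) :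
      Move [⟨l ++ [e], .cross c (!e) p, r⟩, ⟨l, .cap e, c :: r⟩]
        [⟨l, .cross e c (!p), (!e) :: r⟩, ⟨l ++ [c], .cap e, r⟩]
  /-- The first Reidemeister move, at a local minimum. -/
  | reidemeister_one_cup (l r : List Bool) (e p : Bool) :
      Move [⟨l, .cup e, r⟩, ⟨l, .cross e (!e) p, r⟩] [⟨l, .cup (!e), r⟩]
  /-- The first Reidemeister move, at a local maximum. -/
  | reidemeister_one_cap (l r : List Bool) (e p : Bool) :
      Move [⟨l, .cross e (!e) p, r⟩, ⟨l, .cap (!e), r⟩] [⟨l, .cap e, r⟩]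
  /-- The second Reidemeister move. -/
  | reidemeister_two (l r : List Bool) (a b p : Bool) :
      Move [⟨l, .cross a b p, r⟩, ⟨l, .cross b a (!p), r⟩] []
  /-- The third Reidemeister move for strands `a`, `b`, `c`.  Here `p`, `q`, `s` tell whether `a` is
  over `b`, `a` is over `c`, `b` is over `c`, respectively; the condition says that one of the three
  strands lies above the two others and one lies below the two others. -/
  | reidemeister_three (l r : List Bool) (a b c p q s : Bool) (h : q = p ∨ q = s) :
      Move [⟨l, .cross a b p, c :: r⟩, ⟨l ++ [b], .cross a c q, r⟩, ⟨l, .cross b c s, a :: r⟩]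
        [⟨l ++ [a], .cross b c s, r⟩, ⟨l, .cross a c q, b :: r⟩, ⟨l ++ [c], .cross a b p, r⟩]

/-- One diagram arises from the other by a single local move. -/
def LinkDiagram.MovesTo (D E : LinkDiagram) : Prop :=
  ∃ u v x y, Move x y ∧ D.slices = u ++ x ++ v ∧ E.slices = u ++ y ++ v

/-- Isotopy classes of oriented links in the three-sphere: link diagrams up to the equivalence
relation that is generated by isotopies of the plane and Reidemeister moves. -/
def Link : Type := Quot LinkDiagram.MovesTo

/-- `D` is a diagram of the link `L`. -/
def LinkDiagram.IsDiagramOf (D : LinkDiagram) (L : Link) : Prop := Quot.mk _ D = L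

/-- A link is a knot if it has exactly one component. -/
def Link.IsKnot (L : Link) : Prop := ∃ D : LinkDiagram, D.IsDiagramOf L ∧ D.componentCount = 1

/-- Isotopy classes of oriented knots in the three-sphere.  A real-valued knot invariant is a
function `Knot → ℝ`. -/
def Knot : Type := {L : Link // L.IsKnot}

/-- The slices of the crossingless diagram of `k` unnested circles, one above the other. -/
def circles : ℕ → List Slice
  | 0 => []
  | k + 1 => ⟨[], .cup true, []⟩ :: ⟨[], .cap true, []⟩ :: circles k

theorem isTangle_circles (k : ℕ) : IsTangle [] (circles k) [] := by
  induction k with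
  | zero => rfl
  | succ k ih => exact ⟨rfl, rfl, ih⟩

/-- The unlink with `k` components. -/
def unlink (k : ℕ) : Link := Quot.mk _ ⟨circles k, isTangle_circles k⟩

/-! ## Braids -/

/-- The relations of the Artin presentation, for the generators `σ 0, …, σ (n - 2)`. -/
def braidRels (n : ℕ) : Set (FreeGroup (Fin (n - 1))) :=
  {r | ∃ i j : Fin (n - 1), (j : ℕ) = i + 1 ∧
      r = (FreeGroup.of i * FreeGroup.of j * FreeGroup.of i) *
        (FreeGroup.of j * FreeGroup.of i * FreeGroup.of j)⁻¹} ∪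
  {r | ∃ i j : Fin (n - 1), (i : ℕ) + 2 ≤ j ∧
      r = (FreeGroup.of i * FreeGroup.of j) * (FreeGroup.of j * FreeGroup.of i)⁻¹}

/-- The braid group `B_n` on `n` strings. -/
abbrev BraidGroup (n : ℕ) : Type := PresentedGroup (braidRels n)

/-- The braid that is represented by a word in the Artin generators; `(i, true)` stands for the
`i`-th generator and `(i, false)` for its inverse. -/
def braidOfWord {n : ℕ} (w : List (Fin (n - 1) × Bool)) : BraidGroup n :=
  PresentedGroup.mk (braidRels n) (FreeGroup.mk w)

theorem lk_aux (n : ℕ) : ∀ r ∈ braidRels n,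
    FreeGroup.lift (fun _ : Fin (n - 1) => Multiplicative.ofAdd (1 : ℤ)) r = 1 := by
  rintro r (⟨i, j, -, rfl⟩ | ⟨i, j, -, rfl⟩) <;> simp

/-- The linking number homomorphism `lk : B_n → ℤ`, which maps each Artin generator to `1`. -/
def lk {n : ℕ} : BraidGroup n →* Multiplicative ℤ := PresentedGroup.toGroup (lk_aux n)

/-! ### The closure of a braid -/

/-- The slice of a letter of a braid word: the strings run upwards, and to the right of them are the
`n` downward strands of the closure.  The generators give positive crossings. -/
def letterSlice (n : ℕ) (x : Fin (n - 1) × Bool) : Slice :=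
  ⟨List.replicate x.1 true, .cross true true x.2,
    List.replicate (n - 2 - x.1) true ++ List.replicate n false⟩

/-- `n` nested local minima. -/
def nestedCups : ℕ → List Slice
  | 0 => []
  | n + 1 => nestedCups n ++ [⟨List.replicate n true, .cup true, List.replicate n false⟩]

/-- `n` nested local maxima. -/
def nestedCaps : ℕ → List Slice
  | 0 => []
  | n + 1 => ⟨List.replicate n true, .cap true, List.replicate n false⟩ :: nestedCaps n

theorem replicate_level (n : ℕ) :
    List.replicate n true ++ [true, false] ++ List.replicate n false =
      List.replicate (n + 1) true ++ List.replicate (n + 1) false := by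
  rw [List.replicate_succ' (a := true), List.replicate_succ (a := false)]
  simp

theorem isTangle_nestedCups (n : ℕ) :
    IsTangle [] (nestedCups n) (List.replicate n true ++ List.replicate n false) := by
  induction n with
  | zero => rfl
  | succ n ih =>
    refine ih.append ⟨?_, ?_⟩
    · simp [Slice.dom, Piece.dom]
    · exact replicate_level n

theorem isTangle_nestedCaps (n : ℕ) :
    IsTangle (List.replicate n true ++ List.replicate n false) (nestedCaps n) [] := by
  induction n with
  | zero => rfl
  | succ n ih =>
    refine ⟨replicate_level n, ?_⟩
    simpa [Slice.cod, Piece.cod] using ih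

theorem letterSlice_dom (n : ℕ) (x : Fin (n - 1) × Bool) :
    (letterSlice n x).dom = List.replicate n true ++ List.replicate n false := by
  have h : (x.1 : ℕ) + (2 + (n - 2 - x.1)) = n := by have := x.1.2; omega
  have e : List.replicate n true = List.replicate x.1 true ++
      ([true, true] ++ List.replicate (n - 2 - x.1) true) := by
    conv_lhs => rw [← h]
    rw [List.replicate_add, List.replicate_add]
    rfl
  rw [e]
  simp [letterSlice, Slice.dom, Piece.dom]

theorem letterSlice_cod (n : ℕ) (x : Fin (n - 1) × Bool) :
    (letterSlice n x).cod = List.replicate n true ++ List.replicate n false :=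
  letterSlice_dom n x

theorem isTangle_letters (n : ℕ) (w : List (Fin (n - 1) × Bool)) :
    IsTangle (List.replicate n true ++ List.replicate n false) (w.map (letterSlice n))
      (List.replicate n true ++ List.replicate n false) := by
  induction w with
  | nil => rfl
  | cons x w ih => exact ⟨letterSlice_dom n x, by rw [letterSlice_cod]; exact ih⟩

/-- The diagram of the closure of a braid word: the braid, read from the bottom to the top, whose
strings run upwards and are closed up by `n` parallel strands to the right of it. -/
def closureDiagram {n : ℕ} (w : List (Fin (n - 1) × Bool)) : LinkDiagram where
  slices := nestedCups n ++ w.map (letterSlice n) ++ nestedCaps n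
  closed := ((isTangle_nestedCups n).append (isTangle_letters n w)).append (isTangle_nestedCaps n)

/-- The closure of a braid word as a link. -/
def wordClosure {n : ℕ} (w : List (Fin (n - 1) × Bool)) : Link := Quot.mk _ (closureDiagram w)

theorem wordClosure_move {n : ℕ} (u v x y : List (Fin (n - 1) × Bool))
    (h : Move (x.map (letterSlice n)) (y.map (letterSlice n))) :
    wordClosure (u ++ x ++ v) = wordClosure (u ++ y ++ v) :=
  Quot.sound ⟨nestedCups n ++ u.map (letterSlice n), v.map (letterSlice n) ++ nestedCaps n, _, _, h,
    by simp [closureDiagram], by simp [closureDiagram]⟩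

/-- Two braid words are related if replacing one by the other does not change the closure of any
braid word. -/
def wordCon (n : ℕ) : Con (FreeMonoid (Fin (n - 1) × Bool)) where
  r x y := ∀ u v : FreeMonoid (Fin (n - 1) × Bool),
    wordClosure (FreeMonoid.toList (u * x * v)) = wordClosure (FreeMonoid.toList (u * y * v))
  iseqv := ⟨fun _ _ _ => rfl, fun h u v => (h u v).symm, fun h k u v => (h u v).trans (k u v)⟩
  mul' := by
    intro x x' y y' h k u v
    have h1 := h u (y * v)
    have h2 := k (u * x') v
    simp only [mul_assoc] at h1 h2 ⊢
    exact h1.trans h2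

/-- The class of a letter. -/
def letterClass (n : ℕ) (x : Fin (n - 1) × Bool) : (wordCon n).Quotient :=
  ((FreeMonoid.of x : FreeMonoid (Fin (n - 1) × Bool)) : (wordCon n).Quotient)

theorem letterClass_inv (n : ℕ) (i : Fin (n - 1)) (b : Bool) :
    letterClass n (i, b) * letterClass n (i, !b) = 1 := by
  refine (Con.eq (wordCon n)).2 fun u v => ?_
  exact wordClosure_move u.toList v.toList [(i, b), (i, !b)] []
    (Move.reidemeister_two _ _ true true b)

theorem letterClass_far (n : ℕ) (i j : Fin (n - 1)) (h : (i : ℕ) + 2 ≤ j) :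
    letterClass n (i, true) * letterClass n (j, true) =
      letterClass n (j, true) * letterClass n (i, true) := by
  refine (Con.eq (wordCon n)).2 fun u v => ?_
  refine wordClosure_move u.toList v.toList [(i, true), (j, true)] [(j, true), (i, true)] ?_
  have hj := j.2
  have h1 : n - 2 - (i : ℕ) = (j - i - 2) + (2 + (n - 2 - j)) := by omega
  have h2 : (j : ℕ) = i + (2 + (j - i - 2)) := by omega
  have key := Move.exchange (List.replicate i true) (List.replicate (j - i - 2) true)
    (List.replicate (n - 2 - j) true ++ List.replicate n false)
    (.cross true true true) (.cross true true true)
  have e1 : List.replicate (n - 2 - (i : ℕ)) true ++ List.replicate n false =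
      List.replicate (j - i - 2) true ++ [true, true] ++
        (List.replicate (n - 2 - j) true ++ List.replicate n false) := by
    rw [h1, List.replicate_add, List.replicate_add]
    simp [List.replicate]
  have e2 : List.replicate (j : ℕ) true =
      List.replicate i true ++ [true, true] ++ List.replicate (j - i - 2) true := by
    conv_lhs => rw [h2]
    rw [List.replicate_add, List.replicate_add]
    simp [List.replicate]
  simp only [List.map, letterSlice]
  rw [e1, e2]
  exact key

theorem letterClass_braid (n : ℕ) (i j : Fin (n - 1)) (h : (j : ℕ) = i + 1) :
    letterClass n (i, true) * letterClass n (j, true) * letterClass n (i, true) =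
      letterClass n (j, true) * letterClass n (i, true) * letterClass n (j, true) := by
  refine (Con.eq (wordCon n)).2 fun u v => ?_
  refine wordClosure_move u.toList v.toList [(i, true), (j, true), (i, true)]
    [(j, true), (i, true), (j, true)] ?_
  have hj := j.2
  have h1 : n - 2 - (i : ℕ) = (n - 2 - j) + 1 := by omega
  have key := Move.reidemeister_three (List.replicate i true)
    (List.replicate (n - 2 - j) true ++ List.replicate n false) true true true true true true
    (Or.inl rfl)
  have e1 : List.replicate (n - 2 - (i : ℕ)) true ++ List.replicate n false =
      true :: (List.replicate (n - 2 - j) true ++ List.replicate n false) := by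
    rw [h1, List.replicate_succ, List.cons_append]
  have e2 : List.replicate (j : ℕ) true = List.replicate i true ++ [true] := by
    rw [h, List.replicate_succ']
  simp only [List.map, letterSlice]
  rw [e1, e2]
  exact key

/-- The class of an Artin generator, as an invertible element. -/
def generatorUnit (n : ℕ) (i : Fin (n - 1)) : ((wordCon n).Quotient)ˣ :=
  ⟨letterClass n (i, true), letterClass n (i, false), letterClass_inv n i true,
    letterClass_inv n i false⟩

theorem generatorUnit_rels (n : ℕ) :
    ∀ r ∈ braidRels n, FreeGroup.lift (generatorUnit n) r = 1 := by
  rintro r (⟨i, j, h, rfl⟩ | ⟨i, j, h, rfl⟩)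
  · rw [map_mul, map_inv, mul_inv_eq_one]
    simp only [map_mul, FreeGroup.lift_apply_of]
    exact Units.ext (letterClass_braid n i j h)
  · rw [map_mul, map_inv, mul_inv_eq_one]
    simp only [map_mul, FreeGroup.lift_apply_of]
    exact Units.ext (letterClass_far n i j h)

/-- The closure of a braid as a link.  It is well-defined on the braid group because the braid
relations and the cancellation of inverse letters are realized by the local moves. -/
def braidClosure {n : ℕ} (β : BraidGroup n) : Link :=
  Con.liftOn ((PresentedGroup.toGroup (generatorUnit_rels n) β : ((wordCon n).Quotient)ˣ) :
      (wordCon n).Quotient)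
    (fun w => wordClosure (FreeMonoid.toList w))
    (fun x y h => by simpa using h 1 1)

/-- The closure of a braid is the closure of any word that represents the braid. -/
theorem braidClosure_braidOfWord {n : ℕ} (w : List (Fin (n - 1) × Bool)) :
    braidClosure (braidOfWord w) = wordClosure w := by
  have key : ((PresentedGroup.toGroup (generatorUnit_rels n) (braidOfWord w) :
      ((wordCon n).Quotient)ˣ) : (wordCon n).Quotient) =
      ((FreeMonoid.ofList w : FreeMonoid (Fin (n - 1) × Bool)) : (wordCon n).Quotient) := by
    have h0 : PresentedGroup.toGroup (generatorUnit_rels n) (braidOfWord w) =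
        FreeGroup.lift (generatorUnit n) (FreeGroup.mk w) := rfl
    rw [h0, FreeGroup.lift_mk]
    induction w with
    | nil => rfl
    | cons x w ih =>
      have ih' := ih rfl
      rw [List.map_cons, List.prod_cons, Units.val_mul, ih']
      obtain ⟨i, b⟩ := x
      cases b <;> rfl
  unfold braidClosure
  rw [key]
  rfl

/-! ## Functions on braid groups that are induced by knot invariants -/

/-- `α` is a completing braid for `β`: the closure of `α β` is a knot, and the closure of `α` is an
unlink with `k` components for some `1 ≤ k ≤ n`. -/
structure IsCompletingBraid {n : ℕ} (β α : BraidGroup n) : Prop where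
  isKnot : (braidClosure (α * β)).IsKnot
  isUnlink : ∃ k : ℕ, 1 ≤ k ∧ k ≤ n ∧ braidClosure α = unlink k

/-- The function on the braid group induced by a knot invariant `I` and a choice of completing
braids: `β` is mapped to the value of `I` at the closure of `α β * β`. -/
def inducedFunction {n : ℕ} (I : Knot → ℝ) (α : BraidGroup n → BraidGroup n)
    (hα : ∀ β, IsCompletingBraid β (α β)) (β : BraidGroup n) : ℝ :=
  I ⟨braidClosure (α β * β), (hα β).isKnot⟩

/-- Quasi-morphisms on a group. -/
def IsQuasimorphism {G : Type*} [Group G] (φ : G → ℝ) : Prop :=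
  ∃ C : ℝ, 0 < C ∧ ∀ a b : G, |φ (a * b) - φ a - φ b| ≤ C

/-- The homogenization of a quasi-morphism. -/
noncomputable def homogenization {G : Type*} [Group G] (φ : G → ℝ) (a : G) : ℝ :=
  limUnder atTop fun k : ℕ => φ (a ^ k) / k

/-! ## Counting the two-colourings of a diagram -/

/-! Call a braid pure if it permutes its strings trivially. If `β` is pure, the closures of `α β`
and `α` have equally many components. For a completing braid `α` the first closure is a knot and the
second an unlink, so the second is the unknot `U`. The Seifert circles of a closed braid diagram on
`n` strings depend on `n` alone; call their number `o`. The two bounds on `I` therefore say that `I`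
of a knotted closure differs from the exponent sum by at most `o` (`abs_sub_lk_le`). Applied to `α`,
this keeps `lk α` within `o` of the fixed number `I U`. Applied to `α β`, it then keeps the induced
function within `2 o + |I U|` of `lk β`. An arbitrary braid has a pure power `β ^ m`, so the
estimate holds along all multiples of `m`. The quasi-morphism inequality extends it to every
exponent with a bounded error, and dividing by the exponent gives the limit
(`tendsto_div_of_close_on_multiples`).

Components are compared through two-colourings, whose number is a link invariant computed level by
level (`Move.extendTangle_eq`). It is `2 ^ k` for the unlink with `k` components and at most `2` for
a knot. Purity becomes triviality of the action of the word on the colourings of a level, `wordPerm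
n v = 1`; then `2 ^ k ≤ 2` forces `k = 1`. -/

theorem List.exists_append_of_length_eq {α β : Type*} {a : List α} {l r : List β}
    (h : a.length = (l ++ r).length) :
    ∃ b c, a = b ++ c ∧ b.length = l.length ∧ c.length = r.length :=
  ⟨a.take l.length, a.drop l.length, by simp, by simp at h ⊢; omega, by simp at h ⊢; omega⟩

theorem List.exists_cons_of_length_eq {α β : Type*} {a : List α} {r : List β} {x : β}
    (h : a.length = (x :: r).length) : ∃ u c, a = u :: c ∧ c.length = r.length := by
  cases a with
  | nil => simp at h
  | cons u c => exact ⟨u, c, rfl, by simpa using h⟩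

/-- The colourings of the top of a piece that extend a given colouring of its bottom. -/
def Piece.extend : Piece → List Bool → Multiset (List Bool)
  | cup _, [] => {[false, false], [true, true]}
  | cap _, [u, v] => if u = v then {[]} else 0
  | cross _ _ _, [u, v] => {[v, u]}
  | _, _ => 0

/-- The colourings of the level above a slice that extend a given colouring of the level below. -/
def Slice.extend (x : Slice) (a : List Bool) : Multiset (List Bool) :=
  (x.piece.extend ((a.drop x.left.length).take x.piece.dom.length)).map fun b =>
    a.take x.left.length ++ (b ++ a.drop (x.left.length + x.piece.dom.length))

theorem Piece.length_of_mem_extend {x : Piece} {a b : List Bool} (hb : b ∈ x.extend a) :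
    b.length = x.cod.length := by
  revert hb
  fun_cases Piece.extend x a <;> simp +contextual [Piece.cod]
  rintro (rfl | rfl) <;> rfl

theorem Piece.nodup_extend (x : Piece) (a : List Bool) : (x.extend a).Nodup := by
  fun_cases Piece.extend x a <;> simp

namespace Slice

/-- Replaces the `take` and `drop` of the definition by an explicit splitting of the colouring, the
form in which all local computations are done. -/
theorem extend_append {l a b : List Bool} (ha : a.length = l.length) (x : Piece)
    (hb : b.length = x.dom.length) (r c : List Bool) :
    extend ⟨l, x, r⟩ (a ++ (b ++ c)) = (x.extend b).map fun b' => a ++ (b' ++ c) := by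
  simp [extend, ← ha, ← hb, ← List.drop_drop]

theorem extend_cup {l a : List Bool} (h : a.length = l.length) (e : Bool) (r b : List Bool) :
    extend ⟨l, .cup e, r⟩ (a ++ b) = {a ++ false :: false :: b, a ++ true :: true :: b} := by
  simpa [Piece.extend] using extend_append h (.cup e) (b := []) rfl r b

theorem extend_cap {l a : List Bool} (h : a.length = l.length) (e : Bool) (r b : List Bool)
    (u v : Bool) :
    extend ⟨l, .cap e, r⟩ (a ++ u :: v :: b) = if u = v then {a ++ b} else 0 := by
  have := extend_append h (.cap e) (b := [u, v]) rfl r b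
  by_cases huv : u = v <;> simpa [Piece.extend, huv] using this

theorem extend_cross {l a : List Bool} (h : a.length = l.length) (c d p : Bool)
    (r b : List Bool) (u v : Bool) :
    extend ⟨l, .cross c d p, r⟩ (a ++ u :: v :: b) = {a ++ v :: u :: b} := by
  simpa [Piece.extend] using extend_append h (.cross c d p) (b := [u, v]) rfl r b

/-- A colouring of the level below a slice, cut into its three parts. -/
theorem exists_split {x : Slice} {a : List Bool} (ha : a.length = x.dom.length) :
    ∃ a₁ a₂ a₃, a = a₁ ++ (a₂ ++ a₃) ∧ a₁.length = x.left.length ∧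
      a₂.length = x.piece.dom.length ∧ a₃.length = x.right.length := by
  rw [Slice.dom, List.append_assoc] at ha
  obtain ⟨a₁, b, rfl, h₁, h⟩ := List.exists_append_of_length_eq ha
  obtain ⟨a₂, a₃, rfl, h₂, h₃⟩ := List.exists_append_of_length_eq h
  exact ⟨a₁, a₂, a₃, rfl, h₁, h₂, h₃⟩

theorem length_of_mem_extend {x : Slice} {a b : List Bool} (ha : a.length = x.dom.length)
    (hb : b ∈ x.extend a) : b.length = x.cod.length := by
  obtain ⟨a₁, a₂, a₃, rfl, h₁, h₂, h₃⟩ := exists_split ha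
  rw [extend_append h₁ _ h₂] at hb
  obtain ⟨b, hb', rfl⟩ := Multiset.mem_map.1 hb
  simp [Slice.cod, h₁, h₃, Piece.length_of_mem_extend hb']

theorem nodup_extend (x : Slice) (a : List Bool) : (x.extend a).Nodup :=
  (x.piece.nodup_extend _).map fun b b' h => by simpa using h

end Slice

/-- The colourings of the top level that extend a given colouring of the bottom level, with
multiplicity. -/
def extendTangle : List Slice → List Bool → Multiset (List Bool)
  | [], a => {a}
  | x :: w, a => (x.extend a).bind (extendTangle w)

theorem bind_extendTangle_nil (s : Multiset (List Bool)) : s.bind (extendTangle []) = s :=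
  (Multiset.bind_singleton _ id).trans (Multiset.map_id _)

theorem extendTangle_append (v w : List Slice) (a : List Bool) :
    extendTangle (v ++ w) a = (extendTangle v a).bind (extendTangle w) := by
  induction v generalizing a with
  | nil => simp [extendTangle]
  | cons x v ih => simp only [List.cons_append, extendTangle, ih, Multiset.bind_assoc]

theorem length_of_mem_extendTangle {s t a b : List Bool} {w : List Slice} (hw : IsTangle s w t)
    (ha : a.length = s.length) (hb : b ∈ extendTangle w a) : b.length = t.length := by
  induction w generalizing s a with
  | nil => cases hw; rw [Multiset.mem_singleton.1 hb, ha]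
  | cons x w ih =>
    obtain ⟨rfl, hw⟩ := hw
    obtain ⟨c, hc, hb⟩ := Multiset.mem_bind.1 hb
    exact ih hw (Slice.length_of_mem_extend ha hc) hb

theorem IsTangle.exists_of_append {s t : List Bool} {v w : List Slice}
    (h : IsTangle s (v ++ w) t) : ∃ u, IsTangle s v u ∧ IsTangle u w t := by
  induction v generalizing s with
  | nil => exact ⟨s, rfl, h⟩
  | cons x v ih =>
    obtain ⟨u, h₁, h₂⟩ := ih h.2
    exact ⟨u, ⟨h.1, h₁⟩, h₂⟩

/-! ### Invariance of the number of colourings under the local moves -/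

theorem extendTangle_exchange (x y : Piece) {l m r a₁ ax a₂ ay a₃ : List Bool}
    (h₁ : a₁.length = l.length) (hx : ax.length = x.dom.length) (h₂ : a₂.length = m.length)
    (hy : ay.length = y.dom.length) :
    extendTangle [⟨l, x, m ++ y.dom ++ r⟩, ⟨l ++ x.cod ++ m, y, r⟩]
        (a₁ ++ (ax ++ (a₂ ++ (ay ++ a₃)))) =
      extendTangle [⟨l ++ x.dom ++ m, y, r⟩, ⟨l, x, m ++ y.cod ++ r⟩]
        (a₁ ++ (ax ++ (a₂ ++ (ay ++ a₃)))) := by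
  have h₃ : (a₁ ++ (ax ++ a₂)).length = (l ++ x.dom ++ m).length := by simp [*]
  have e₃ := Slice.extend_append h₃ y hy r a₃
  simp only [List.append_assoc] at e₃
  simp only [extendTangle.eq_2, Slice.extend_append h₁ x hx, List.append_assoc, e₃,
    Multiset.bind_map]
  -- The common value of both sides: the two pieces are extended independently, and
  -- `Multiset.bind_bind` exchanges the order.
  trans (x.extend ax).bind fun bx => (y.extend ay).bind fun b =>
    {a₁ ++ (bx ++ (a₂ ++ (b ++ a₃)))}
  · refine Multiset.bind_congr fun bx hbx => ?_
    have h₄ : (a₁ ++ (bx ++ a₂)).length = (l ++ (x.cod ++ m)).length := by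
      simp [*, Piece.length_of_mem_extend hbx]
    have e₄ := Slice.extend_append h₄ y hy r a₃
    simp only [List.append_assoc] at e₄
    simp [bind_extendTangle_nil, e₄]
  · rw [Multiset.bind_bind]
    simp [extendTangle]

/-- Colours ignore directions and over/under information, so crossings merely transpose colours and
the third Reidemeister move becomes the braid relation for transpositions. Multiplicities agree
because no move creates or destroys a closed curve: in a zigzag, exactly one of the two colours of
the minimum survives the maximum. -/
theorem Move.extendTangle_eq {x y : List Slice} (h : Move x y) {s t a : List Bool}
    (hx : IsTangle s x t) (ha : a.length = s.length) : extendTangle x a = extendTangle y a := by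
  cases h with
  | exchange l m r x y =>
    obtain ⟨rfl, -⟩ := hx
    obtain ⟨a₁, ax, b, rfl, h₁, hx, h⟩ := Slice.exists_split ha
    rw [List.append_assoc] at h
    obtain ⟨a₂, b, rfl, h₂, h⟩ := List.exists_append_of_length_eq h
    obtain ⟨ay, a₃, rfl, hy, h₃⟩ := List.exists_append_of_length_eq h
    exact extendTangle_exchange x y h₁ hx h₂ hy
  | zigzag_left l r a =>
    obtain ⟨rfl, -⟩ := hx
    obtain ⟨a₁, _ | _, a₃, rfl, h₁, h₂, h₃⟩ := Slice.exists_split ha <;> simp [Piece.dom] at h₂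
    obtain ⟨a₁, b, rfl, h₅, h₂⟩ := List.exists_append_of_length_eq h₁
    obtain ⟨u, rfl⟩ := List.length_eq_one_iff.1 h₂
    have h₄ : (a₁ ++ [u]).length = (l ++ [a]).length := by simp [h₅]
    have e₄ := Slice.extend_cup h₄ (!a) r a₃
    simp only [List.append_assoc, List.singleton_append] at e₄
    cases u <;> simp [extendTangle, e₄, Slice.extend_cap h₅]
  | zigzag_right l r a =>
    obtain ⟨rfl, -⟩ := hx
    obtain ⟨a₁, _ | _, a₃, rfl, h₁, h₂, h₃⟩ := Slice.exists_split ha <;> simp [Piece.dom] at h₂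
    obtain ⟨u, b, rfl, h₃⟩ := List.exists_cons_of_length_eq h₃
    -- The colour `z` varies because the minimum produces both colours.
    have h₄ (z) : (a₁ ++ [z]).length = (l ++ [a]).length := by simp [h₁]
    have h₅ (z) := Slice.extend_cap (h₄ z) (!a) r b
    simp only [List.append_assoc, List.singleton_append] at h₅
    cases u <;> simp [extendTangle, Slice.extend_cup h₁, h₅]
  | slide_cup l r e c p =>
    obtain ⟨rfl, -⟩ := hx
    obtain ⟨a₁, _ | _, a₃, rfl, h₁, h₂, h₃⟩ := Slice.exists_split ha <;> simp [Piece.dom] at h₂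
    obtain ⟨u, b, rfl, h₃⟩ := List.exists_cons_of_length_eq h₃
    have h₄ (f z) : (a₁ ++ [z]).length = (l ++ [f]).length := by simp [h₁]
    have h₅ (z) := Slice.extend_cross (h₄ e z) (!e) c p r b
    have h₆ (z) := Slice.extend_cup (h₄ c z) e r b
    simp only [List.append_assoc, List.singleton_append] at h₅ h₆
    simp [extendTangle, Slice.extend_cup h₁, h₅, h₆, Slice.extend_cross h₁]
  | slide_cap l r e c p =>
    obtain ⟨rfl, -⟩ := hx
    obtain ⟨a₁, b, a₃, rfl, h₁, h₂, h₃⟩ := Slice.exists_split ha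
    obtain ⟨a₁, z, rfl, h, hz⟩ := List.exists_append_of_length_eq h₁
    obtain ⟨z, rfl⟩ := List.length_eq_one_iff.1 hz
    obtain ⟨u, v, rfl⟩ := List.length_eq_two.1 h₂
    have h₄ (f z) : (a₁ ++ [z]).length = (l ++ [f]).length := by simp [h]
    have h₅ (z) := Slice.extend_cross (h₄ e z) c (!e) p r a₃
    have h₆ (z) := Slice.extend_cap (h₄ c z) e r a₃
    simp only [List.append_assoc, List.singleton_append] at h₅ h₆
    cases z <;> cases u <;> cases v <;>
      simp [extendTangle, Slice.extend_cap h, h₅, h₆, Slice.extend_cross h]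
  | reidemeister_one_cup l r e p =>
    obtain ⟨rfl, -⟩ := hx
    obtain ⟨a₁, _ | _, a₃, rfl, h₁, h₂, h₃⟩ := Slice.exists_split ha <;> simp [Piece.dom] at h₂
    simp [extendTangle, Slice.extend_cup h₁, Slice.extend_cross h₁]
  | reidemeister_one_cap l r e p =>
    obtain ⟨rfl, -⟩ := hx
    obtain ⟨a₁, b, a₃, rfl, h₁, h₂, h₃⟩ := Slice.exists_split ha
    obtain ⟨u, v, rfl⟩ := List.length_eq_two.1 h₂
    cases u <;> cases v <;> simp [extendTangle, Slice.extend_cap h₁, Slice.extend_cross h₁]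
  | reidemeister_two l r c d p =>
    obtain ⟨rfl, -⟩ := hx
    obtain ⟨a₁, b, a₃, rfl, h₁, h₂, h₃⟩ := Slice.exists_split ha
    obtain ⟨u, v, rfl⟩ := List.length_eq_two.1 h₂
    simp [extendTangle, Slice.extend_cross h₁]
  | reidemeister_three l r a b c p q s hpqs =>
    obtain ⟨rfl, -⟩ := hx
    obtain ⟨a₁, d, a₃, rfl, h₁, h₂, h₃⟩ := Slice.exists_split ha
    obtain ⟨u, v, rfl⟩ := List.length_eq_two.1 h₂
    obtain ⟨x, a₃, rfl, h₃⟩ := List.exists_cons_of_length_eq h₃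
    have h₄ (f z) : (a₁ ++ [z]).length = (l ++ [f]).length := by simp [h₁]
    have h₅ (f z c d p) := Slice.extend_cross (h₄ f z) c d p r a₃
    simp only [List.append_assoc, List.singleton_append] at h₅
    simp [extendTangle, Slice.extend_cross h₁, h₅]

/-- The number of two-colourings of the components of a diagram. -/
def LinkDiagram.coloringCount (D : LinkDiagram) : ℕ := (extendTangle D.slices []).card

/-- The move affects only the middle factor of the composite below, inside and above it. Colourings
that arrive from below have the length required by the local statement. -/
theorem LinkDiagram.MovesTo.coloringCount_eq {D E : LinkDiagram} (h : D.MovesTo E) :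
    D.coloringCount = E.coloringCount := by
  obtain ⟨u, v, x, y, hxy, hD, hE⟩ := h
  have hc := D.closed
  rw [hD, List.append_assoc] at hc
  obtain ⟨s, hu, hc⟩ := hc.exists_of_append
  obtain ⟨t, hx, hv⟩ := hc.exists_of_append
  unfold coloringCount
  rw [hD, hE]
  simp only [List.append_assoc, extendTangle_append]
  congr 1
  refine Multiset.bind_congr fun a ha => ?_
  rw [hxy.extendTangle_eq hx (length_of_mem_extendTangle hu rfl ha)]

/-- The number of two-colourings of the components of a link. -/
def Link.coloringCount : Link → ℕ :=
  Quot.lift LinkDiagram.coloringCount fun _ _ h => h.coloringCount_eq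

/-- Each circle doubles the count: its minimum offers two colours and its maximum accepts both. -/
theorem coloringCount_unlink (k : ℕ) : (unlink k).coloringCount = 2 ^ k := by
  change (extendTangle (circles k) []).card = 2 ^ k
  induction k with
  | zero => rfl
  | succ k ih =>
    have h (e r b) := Slice.extend_cup (l := []) (a := []) rfl e r b
    have h' (e r b u v) := Slice.extend_cap (l := []) (a := []) rfl e r b u v
    simp only [List.nil_append] at h h'
    simp [circles, extendTangle, h, h', ih, pow_succ, mul_two]

/-! ## Colourings of diagrams of knots -/

/-- The colourings of all levels of a tangle that extend a given colouring of the bottom level. -/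
def colorings : List Slice → List Bool → Multiset (List (List Bool))
  | [], a => {[a]}
  | x :: w, a => (x.extend a).bind fun b => (colorings w b).map (a :: ·)

theorem card_colorings (w : List Slice) (a : List Bool) :
    (colorings w a).card = (extendTangle w a).card := by
  induction w generalizing a with
  | nil => rfl
  | cons x w ih => simp [colorings, extendTangle, Multiset.card_bind, ih]

theorem getD_zero_of_mem_colorings {w : List Slice} {a : List Bool} {P : List (List Bool)}
    (hP : P ∈ colorings w a) : P.getD 0 [] = a := by
  cases w with
  | nil => rw [Multiset.mem_singleton.1 hP]; rfl
  | cons x w =>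
    obtain ⟨b, -, hP⟩ := Multiset.mem_bind.1 hP
    obtain ⟨Q, -, rfl⟩ := Multiset.mem_map.1 hP
    rfl

/-- Recording all levels makes distinct colourings distinct lists, so an inclusion of supports
bounds the number of colourings. -/
theorem nodup_colorings (w : List Slice) (a : List Bool) : (colorings w a).Nodup := by
  induction w generalizing a with
  | nil => exact Multiset.nodup_singleton _
  | cons x w ih =>
    refine Multiset.nodup_bind.2 ⟨fun b _ => (ih b).map fun P Q h => by simpa using h, ?_⟩
    refine (x.nodup_extend a).pairwise fun b _ c _ hbc => ?_
    refine Multiset.disjoint_left.2 fun {P} hb hc => ?_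
    obtain ⟨Q, hQ, rfl⟩ := Multiset.mem_map.1 hb
    obtain ⟨R, hR, h⟩ := Multiset.mem_map.1 hc
    obtain rfl := (List.cons.inj h).2
    exact hbc ((getD_zero_of_mem_colorings hQ).symm.trans (getD_zero_of_mem_colorings hR))

theorem length_of_mem_colorings {w : List Slice} {a : List Bool} {P : List (List Bool)}
    (hP : P ∈ colorings w a) : P.length = w.length + 1 := by
  induction w generalizing a P with
  | nil => rw [Multiset.mem_singleton.1 hP]; rfl
  | cons x w ih =>
    obtain ⟨b, -, hP⟩ := Multiset.mem_bind.1 hP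
    obtain ⟨Q, hQ, rfl⟩ := Multiset.mem_map.1 hP
    simp [ih hQ]

theorem getD_succ_mem_extend {w : List Slice} {a : List Bool} {P : List (List Bool)}
    (hP : P ∈ colorings w a) {k : ℕ} {x : Slice} (hk : w[k]? = some x) :
    P.getD (k + 1) [] ∈ x.extend (P.getD k []) := by
  induction w generalizing a P k with
  | nil => simp at hk
  | cons y w ih =>
    obtain ⟨b, hb, hP⟩ := Multiset.mem_bind.1 hP
    obtain ⟨Q, hQ, rfl⟩ := Multiset.mem_map.1 hP
    cases k with
    | zero =>
      obtain rfl : y = x := by simpa using hk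
      simpa only [List.getD_cons_succ, List.getD_cons_zero, getD_zero_of_mem_colorings hQ] using hb
    | succ k => simpa only [List.getD_cons_succ] using ih hQ (by simpa using hk)

theorem length_getD_of_mem_colorings {s t a : List Bool} {w : List Slice} {P : List (List Bool)}
    (hw : IsTangle s w t) (ha : a.length = s.length) (hP : P ∈ colorings w a) {k : ℕ} {x : Slice}
    (hk : w[k]? = some x) : (P.getD k []).length = x.dom.length := by
  induction w generalizing s a P k with
  | nil => simp at hk
  | cons y w ih =>
    obtain ⟨rfl, hw⟩ := hw
    obtain ⟨b, hb, hP⟩ := Multiset.mem_bind.1 hP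
    obtain ⟨Q, hQ, rfl⟩ := Multiset.mem_map.1 hP
    cases k with
    | zero =>
      obtain rfl : y = x := by simpa using hk
      simpa using ha
    | succ k =>
      simpa only [List.getD_cons_succ] using
        ih hw (Slice.length_of_mem_extend ha hb) hQ (by simpa using hk)

theorem length_getD_last_of_mem_colorings {s t a : List Bool} {w : List Slice}
    {P : List (List Bool)} (hw : IsTangle s w t) (ha : a.length = s.length)
    (hP : P ∈ colorings w a) : (P.getD w.length []).length = t.length := by
  induction w generalizing s a P with
  | nil => cases hw; rw [Multiset.mem_singleton.1 hP]; exact ha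
  | cons y w ih =>
    obtain ⟨rfl, hw⟩ := hw
    obtain ⟨b, hb, hP⟩ := Multiset.mem_bind.1 hP
    obtain ⟨Q, hQ, rfl⟩ := Multiset.mem_map.1 hP
    exact ih hw (Slice.length_of_mem_extend ha hb) hQ

/-- Points that are joined by an arc have the same colour. -/
theorem JoinedInSlice.color_eq {s t a : List Bool} {w : List Slice} {P : List (List Bool)}
    (hw : IsTangle s w t) (ha : a.length = s.length) (hP : P ∈ colorings w a) {q r : ℕ × ℕ}
    (h : JoinedInSlice w q r) :
    (P.getD q.1 []).getD q.2 false = (P.getD r.1 []).getD r.2 false := by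
  -- All kinds of arcs are put over one common slice `x`, so that its colouring is split only once.
  obtain ⟨k, x, hk, h'⟩ : ∃ k x, w[k]? = some x ∧
      ((∃ j, j < x.left.length ∧ q = (k, j) ∧ r = (k + 1, j)) ∨
      (∃ j, q = (k, x.left.length + x.piece.dom.length + j) ∧
        r = (k + 1, x.left.length + x.piece.cod.length + j)) ∨
      (∃ e, x.piece = .cup e ∧ q = (k + 1, x.left.length) ∧ r = (k + 1, x.left.length + 1)) ∨
      (∃ e, x.piece = .cap e ∧ q = (k, x.left.length) ∧ r = (k, x.left.length + 1)) ∨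
      (∃ c d p, x.piece = .cross c d p ∧ (q = (k, x.left.length) ∧
        r = (k + 1, x.left.length + 1) ∨ q = (k, x.left.length + 1) ∧
        r = (k + 1, x.left.length)))) := by
    cases h with
    | left k j x hk hj => exact ⟨k, x, hk, .inl ⟨j, hj, rfl, rfl⟩⟩
    | right k j x hk hj => exact ⟨k, x, hk, .inr (.inl ⟨j, rfl, rfl⟩)⟩
    | cup k l r e hk => exact ⟨k, _, hk, .inr (.inr (.inl ⟨e, rfl, rfl, rfl⟩))⟩
    | cap k l r e hk => exact ⟨k, _, hk, .inr (.inr (.inr (.inl ⟨e, rfl, rfl, rfl⟩)))⟩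
    | cross_right k l r c d p hk =>
      exact ⟨k, _, hk, .inr (.inr (.inr (.inr ⟨c, d, p, rfl, .inl ⟨rfl, rfl⟩⟩)))⟩
    | cross_left k l r c d p hk =>
      exact ⟨k, _, hk, .inr (.inr (.inr (.inr ⟨c, d, p, rfl, .inr ⟨rfl, rfl⟩⟩)))⟩
  have hlen := length_getD_of_mem_colorings hw ha hP hk
  have hext := getD_succ_mem_extend hP hk
  clear h
  obtain ⟨l, x, m⟩ := x
  obtain ⟨a₁, a₂, a₃, e, h₁, h₂, h₃⟩ := Slice.exists_split hlen
  rw [e, Slice.extend_append h₁ _ h₂] at hext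
  obtain ⟨b, hb, hb'⟩ := Multiset.mem_map.1 hext
  have hbl := Piece.length_of_mem_extend hb
  simp only at h₁ h₂ h₃ h' hb
  rcases h' with ⟨j, hj, rfl, rfl⟩ | ⟨j, rfl, rfl⟩ | ⟨f, rfl, rfl, rfl⟩ | ⟨f, rfl, rfl, rfl⟩ |
    ⟨c, d, p, rfl, h'⟩
  · simp only [e, ← hb']
    rw [List.getD_append _ _ _ _ (by omega), List.getD_append _ _ _ _ (by omega)]
  · simp only [e, ← hb', ← h₁, ← h₂, ← hbl]
    simp [List.getD_eq_getElem?_getD, List.getElem?_append_right, add_assoc]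
  · obtain rfl := List.eq_nil_of_length_eq_zero h₂
    simp only [← hb', ← h₁]
    have hb : b ∈ ([false, false] ::ₘ {[true, true]} : Multiset (List Bool)) := hb
    rcases Multiset.mem_cons.1 hb with rfl | hb
    · simp [List.getD_eq_getElem?_getD]
    · rw [Multiset.mem_singleton.1 hb]
      simp [List.getD_eq_getElem?_getD]
  · obtain ⟨u, v, rfl⟩ := List.length_eq_two.1 h₂
    simp only [e, ← h₁]
    by_cases huv : u = v
    · simp [huv, List.getD_eq_getElem?_getD]
    · simp [Piece.extend, huv] at hb
  · obtain ⟨u, v, rfl⟩ := List.length_eq_two.1 h₂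
    obtain rfl := Multiset.mem_singleton.1 hb
    rcases h' with ⟨rfl, rfl⟩ | ⟨rfl, rfl⟩ <;> simp only [e, ← hb', ← h₁] <;>
      simp [List.getD_eq_getElem?_getD]

/-- The colour of a point descends to the quotient that counts curves. This has one element, so
every colouring is constant. -/
theorem LinkDiagram.coloringCount_le_two {D : LinkDiagram} (hD : D.componentCount = 1) :
    D.coloringCount ≤ 2 := by
  obtain ⟨hsub, ⟨q₀⟩⟩ := Nat.card_eq_one_iff_unique.1 hD
  induction q₀ using Quot.ind with | mk q₀ => ?_
  -- There is one more level than slices; the final `[]` is the empty top level.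
  let P₀ (e : Bool) : List (List Bool) :=
    D.slices.map (fun x => List.replicate x.dom.length e) ++ [[]]
  have key : colorings D.slices [] ⊆ {P₀ false, P₀ true} := by
    intro P hP
    have hall : ∀ q : {q : ℕ × ℕ // IsPoint D.slices q}, (P.getD q.1.1 []).getD q.1.2 false =
        (P.getD q₀.1.1 []).getD q₀.1.2 false := fun q =>
      congrArg (Quot.lift (fun q : {q : ℕ × ℕ // IsPoint D.slices q} =>
        (P.getD q.1.1 []).getD q.1.2 false) fun _ _ h => h.color_eq D.closed rfl hP)
        (hsub.elim (Quot.mk _ q) (Quot.mk _ q₀))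
    generalize (P.getD q₀.1.1 []).getD q₀.1.2 false = e at hall
    have hPe : P = P₀ e := by
      have hl := length_of_mem_colorings hP
      refine List.ext_getElem (by simp [P₀, hl]) fun k hk _ => ?_
      have hg : P[k] = P.getD k [] := (List.getD_eq_getElem _ _ hk).symm
      rcases (show k < D.slices.length ∨ k = D.slices.length by omega) with h | rfl
      · have hx : D.slices[k]? = some D.slices[k] := List.getElem?_eq_getElem h
        have hlen := length_getD_of_mem_colorings D.closed rfl hP hx
        simp only [P₀]
        rw [List.getElem_append_left (by simpa using h), List.getElem_map, List.eq_replicate_iff, hg]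
        refine ⟨hlen, fun b hb => ?_⟩
        obtain ⟨j, hj, rfl⟩ := List.getElem_of_mem hb
        rw [← hall ⟨(k, j), _, hx, hlen ▸ hj⟩, List.getD_eq_getElem _ _ hj]
      · have hlen := length_getD_last_of_mem_colorings D.closed rfl hP
        simp only [P₀]
        rw [List.getElem_append_right (by simp), hg]
        simpa using List.eq_nil_of_length_eq_zero hlen
    cases e <;> simp [hPe]
  rw [coloringCount, ← card_colorings]
  exact Multiset.card_le_card ((Multiset.le_iff_subset (nodup_colorings _ _)).2 key)

theorem Link.IsKnot.coloringCount_le_two {L : Link} (h : L.IsKnot) : L.coloringCount ≤ 2 := by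
  obtain ⟨D, rfl, hD⟩ := h
  exact D.coloringCount_le_two hD

theorem isKnot_unlink_one : (unlink 1).IsKnot := by
  refine ⟨⟨circles 1, isTangle_circles 1⟩, rfl, Nat.card_eq_one_iff_unique.2 ⟨⟨?_⟩, ⟨?_⟩⟩⟩
  · have hp : ∀ q : {q : ℕ × ℕ // IsPoint (circles 1) q}, q.1 = (1, 0) ∨ q.1 = (1, 1) := by
      rintro ⟨⟨k, j⟩, x, hx, hj⟩
      rcases k with _ | _ | k
      · obtain rfl : _ = x := Option.some.inj hx
        simp [Slice.dom, Piece.dom] at hj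
      · obtain rfl : _ = x := Option.some.inj hx
        simp [Slice.dom, Piece.dom] at hj ⊢
        omega
      · simp [circles] at hx
    have h01 : JoinedInSlice (circles 1) (1, 0) (1, 1) := .cup 0 [] [] true rfl
    rintro ⟨q, hq⟩ ⟨r, hr⟩
    rcases hp ⟨q, hq⟩ with h | h <;> rcases hp ⟨r, hr⟩ with h' | h' <;> simp only at h h' <;>
      subst h h'
    · rfl
    · exact Quot.sound h01
    · symm
      exact Quot.sound h01
    · rfl
  · exact Quot.mk _ ⟨(1, 0), _, rfl, by simp [Slice.dom, Piece.dom]⟩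

/-! ## Braid words -/

/-- The permutation of the colourings of a level of a braid closure that is induced by a letter. -/
def letterPerm (n : ℕ) (x : Fin (n - 1) × Bool) : Equiv.Perm (Fin (n + n) → Bool) :=
  Equiv.arrowCongr (Equiv.swap ⟨x.1, by omega⟩ ⟨x.1 + 1, by omega⟩) (Equiv.refl Bool)

/-- Colourings as functions on `Fin (n + n)` let words act by permutations of a finite set, hence
with finite order. -/
theorem extend_letterSlice (n : ℕ) (x : Fin (n - 1) × Bool) (f : Fin (n + n) → Bool) :
    (letterSlice n x).extend (List.ofFn f) = {List.ofFn (letterPerm n x f)} := by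
  obtain ⟨a₁, a₂, a₃, e, h₁, h₂, h₃⟩ := Slice.exists_split (x := letterSlice n x)
    (a := List.ofFn f) (by simp [letterSlice_dom])
  obtain ⟨u, v, rfl⟩ := List.length_eq_two.1 h₂
  have h₄ : a₁.length = x.1 := by simpa [letterSlice] using h₁
  rw [e]
  refine (Slice.extend_cross h₁ _ _ _ _ a₃ u v).trans (congrArg _ ?_)
  have hl := congrArg List.length e
  have hf (i : Fin (n + n)) : (a₁ ++ u :: v :: a₃)[i.1]? = some (f i) := by
    rw [show a₁ ++ u :: v :: a₃ = List.ofFn f from e.symm]; simp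
  refine List.ext_getElem (by simpa using hl.symm) fun k hk hk' => ?_
  rw [List.getElem_ofFn]
  have hk' : k < n + n := by simpa using hk'
  apply Option.some.inj
  simp only [letterPerm, Equiv.arrowCongr_apply, Function.comp_apply, Equiv.refl_apply,
    Equiv.symm_swap]
  rw [← hf, ← List.getElem?_eq_getElem, Equiv.swap_apply_def]
  split_ifs with h h'
  · have : k = a₁.length := by rw [h₄]; exact congrArg Fin.val h
    subst this
    simp [← h₄]
  · have : k = a₁.length + 1 := by rw [h₄]; exact congrArg Fin.val h'
    subst this
    simp [← h₄]
  · have h1 : k ≠ a₁.length := fun hh => h (Fin.ext (hh.trans h₄))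
    have h2 : k ≠ a₁.length + 1 := fun hh => h' (Fin.ext (by simp [hh, h₄]))
    rcases lt_or_gt_of_ne h1 with h | h
    · rw [List.getElem?_append_left h, List.getElem?_append_left h]
    · obtain ⟨j, rfl⟩ := Nat.exists_eq_add_of_lt (show a₁.length + 1 < k by omega)
      rw [List.getElem?_append_right (by omega), List.getElem?_append_right (by simp; omega),
        show a₁.length + 1 + j + 1 - a₁.length = j + 1 + 1 by omega]
      simp

/-- The permutation of the colourings of a level that is induced by a braid word. -/
def wordPerm (n : ℕ) : List (Fin (n - 1) × Bool) → Equiv.Perm (Fin (n + n) → Bool)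
  | [] => 1
  | x :: w => wordPerm n w * letterPerm n x

/-- The order is reversed because the first letter is the lowest slice and acts first. -/
theorem wordPerm_append (n : ℕ) (u v : List (Fin (n - 1) × Bool)) :
    wordPerm n (u ++ v) = wordPerm n v * wordPerm n u := by
  induction u with
  | nil => rfl
  | cons x u ih => simp [wordPerm, ih, mul_assoc]

theorem wordPerm_flatten_replicate (n m : ℕ) (v : List (Fin (n - 1) × Bool)) :
    wordPerm n (List.replicate m v).flatten = wordPerm n v ^ m := by
  induction m with
  | zero => rfl
  | succ m ih => simp [List.replicate_succ, wordPerm_append, ih, pow_succ]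

theorem extendTangle_letters (n : ℕ) (w : List (Fin (n - 1) × Bool)) (f : Fin (n + n) → Bool) :
    extendTangle (w.map (letterSlice n)) (List.ofFn f) = {List.ofFn (wordPerm n w f)} := by
  induction w generalizing f with
  | nil => rfl
  | cons x w ih => simp [extendTangle, extend_letterSlice, ih, wordPerm]

theorem coloringCount_wordClosure_append {n : ℕ} {v : List (Fin (n - 1) × Bool)}
    (hv : wordPerm n v = 1) (u : List (Fin (n - 1) × Bool)) :
    (wordClosure (u ++ v)).coloringCount = (wordClosure u).coloringCount := by
  change (extendTangle (closureDiagram (u ++ v)).slices []).card =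
    (extendTangle (closureDiagram u).slices []).card
  simp only [closureDiagram, List.append_assoc, extendTangle_append]
  congr 1
  refine Multiset.bind_congr fun a ha => ?_
  obtain ⟨f, rfl⟩ : ∃ f : Fin (n + n) → Bool, a = List.ofFn f := by
    have := length_of_mem_extendTangle (isTangle_nestedCups n) rfl ha
    rw [List.length_append, List.length_replicate, List.length_replicate] at this
    exact ⟨fun i => a[i], List.ext_getElem (by simpa using this) (by simp)⟩
  simp [extendTangle_letters, extendTangle_append, hv]

/-! ### Exponent sum, writhe and Seifert circles -/

/-- The exponent sum of a braid word. -/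
def wordSum {m : ℕ} (w : List (Fin m × Bool)) : ℤ := (w.map fun x => if x.2 then 1 else -1).sum

theorem braidOfWord_append {n : ℕ} (u v : List (Fin (n - 1) × Bool)) :
    braidOfWord (u ++ v) = braidOfWord u * braidOfWord v := by
  rw [braidOfWord, ← FreeGroup.mul_mk, map_mul]; rfl

theorem braidOfWord_flatten_replicate {n : ℕ} (m : ℕ) (v : List (Fin (n - 1) × Bool)) :
    braidOfWord (List.replicate m v).flatten = braidOfWord v ^ m := by
  induction m with
  | zero => exact map_one (PresentedGroup.mk (braidRels n))
  | succ m ih => rw [List.replicate_succ, List.flatten_cons, braidOfWord_append, ih, pow_succ']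

theorem exists_braidOfWord {n : ℕ} (β : BraidGroup n) : ∃ w, braidOfWord w = β := by
  obtain ⟨x, rfl⟩ := PresentedGroup.mk_surjective _ β
  exact ⟨x.toWord, by rw [braidOfWord, FreeGroup.mk_toWord]⟩

theorem lk_braidOfWord {n : ℕ} (w : List (Fin (n - 1) × Bool)) :
    Multiplicative.toAdd (lk (braidOfWord w)) = wordSum w := by
  have h : lk (braidOfWord w) =
    FreeGroup.lift (fun _ : Fin (n - 1) => Multiplicative.ofAdd (1 : ℤ)) (FreeGroup.mk w) := rfl
  rw [h, FreeGroup.lift_mk, wordSum]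
  induction w with
  | nil => rfl
  | cons x w ih =>
    rw [List.map_cons, List.prod_cons, toAdd_mul, ih rfl, List.map_cons, List.sum_cons]
    obtain ⟨i, _ | _⟩ := x <;> rfl

theorem writhe_closureDiagram {n : ℕ} (w : List (Fin (n - 1) × Bool)) :
    (closureDiagram w).writhe = wordSum w := by
  have h₁ : ((nestedCups n).map fun x => x.piece.sign).sum = 0 := by
    induction n with
    | zero => rfl
    | succ n ih =>
      simp only [nestedCups, List.map_append, List.sum_append]
      -- The type of `w` depends on `n`, so the induction generalizes `w`; any word serves here.
      rw [ih []]; rfl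
  have h₂ : ∀ m, ((nestedCaps m).map fun x => x.piece.sign).sum = 0 := by
    intro m
    induction m with
    | zero => rfl
    | succ m ih =>
      rw [nestedCaps, List.map_cons, List.sum_cons, ih]; rfl
  simp only [LinkDiagram.writhe, closureDiagram, List.map_append, List.sum_append, h₁, h₂, wordSum,
    List.map_map, zero_add, add_zero]
  congr 2
  funext x
  cases h : x.2 <;> simp [letterSlice, Piece.sign, h]

/-- At each letter both strands run upwards, so smoothing erases it and leaves only the `n` nested
circles. -/
theorem seifertCount_closureDiagram {n : ℕ} (w : List (Fin (n - 1) × Bool)) :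
    (closureDiagram w).seifertCount = (closureDiagram (n := n) []).seifertCount := by
  have h : (w.map (letterSlice n)).flatMap Slice.smooth = [] := by
    rw [List.flatMap_eq_nil_iff]
    intro x hx
    obtain ⟨y, -, rfl⟩ := List.mem_map.1 hx
    simp [letterSlice, Slice.smooth]
  simp [LinkDiagram.seifertCount, closureDiagram, List.flatMap_append, h]

/-! ## Homogenization -/

/-- A sequence that is additive up to a constant and close to a linear one along the multiples of
some `m` grows linearly. -/
theorem tendsto_div_of_close_on_multiples {f : ℕ → ℝ} {c B C : ℝ} {m : ℕ} (hm : 0 < m)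
    (hf : ∀ k l, |f (k + l) - f k - f l| ≤ C) (hB : ∀ q, |f (m * q) - (m * q : ℕ) * c| ≤ B) :
    Tendsto (fun k : ℕ => f k / k) atTop (𝓝 c) := by
  -- A crude bound, uniform over all remainders modulo `m`.
  set R := ∑ r ∈ Finset.range m, |f r - r * c| with hR
  have key (k : ℕ) : |f k - k * c| ≤ B + C + R := by
    have h₁ := hf (m * (k / m)) (k % m)
    have h₂ := hB (k / m)
    have h₃ : |f (k % m) - (k % m : ℕ) * c| ≤ R :=
      Finset.single_le_sum (f := fun r : ℕ => |f r - r * c|) (fun _ _ => abs_nonneg _)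
        (Finset.mem_range.2 (Nat.mod_lt k hm))
    have h₄ : (k : ℝ) = (m * (k / m) : ℕ) + (k % m : ℕ) := by
      exact_mod_cast (Nat.div_add_mod k m).symm
    rw [Nat.div_add_mod] at h₁
    rw [h₄]
    rw [abs_le] at *
    constructor <;> linarith
  rw [← tendsto_sub_nhds_zero_iff]
  refine squeeze_zero_norm' ?_ (tendsto_const_div_atTop_nhds_zero_nat (B + C + R))
  filter_upwards [eventually_gt_atTop 0] with k hk
  have hk : (0 : ℝ) < k := Nat.cast_pos.2 hk
  rw [Real.norm_eq_abs, div_sub' hk.ne', abs_div, abs_of_pos hk]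
  exact div_le_div_of_nonneg_right (key k) hk.le

/-! ### Completing braids and the main estimate -/

/-- The completing braid of a braid that acts trivially on colourings closes up to the unknot. -/
theorem IsCompletingBraid.braidClosure_eq_unlink_one {n : ℕ} {α : BraidGroup n}
    {v : List (Fin (n - 1) × Bool)} (hv : wordPerm n v = 1)
    (h : IsCompletingBraid (braidOfWord v) α) : braidClosure α = unlink 1 := by
  obtain ⟨k, hk, -, hα⟩ := h.isUnlink
  have hc := h.isKnot.coloringCount_le_two
  obtain ⟨u, rfl⟩ := exists_braidOfWord α
  rw [← braidOfWord_append, braidClosure_braidOfWord, coloringCount_wordClosure_append hv,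
    ← braidClosure_braidOfWord, hα, coloringCount_unlink] at hc
  have hk' : k ≤ 1 := (Nat.pow_le_pow_iff_right one_lt_two).1 (hc.trans_eq (pow_one 2).symm)
  have : k = 1 := le_antisymm hk' hk
  rw [hα, this]

/-- The writhe of a closed braid diagram is the exponent sum of the word, so the hypothesis on `I`
gives the bound, even with `1` to spare. -/
theorem abs_sub_lk_le {n : ℕ} {I : Knot → ℝ}
    (hI : ∀ (K : Knot) (D : LinkDiagram), D.IsDiagramOf K.1 →
      1 + (D.writhe : ℝ) - (D.seifertCount : ℝ) ≤ I K ∧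
        I K ≤ -1 + (D.writhe : ℝ) + (D.seifertCount : ℝ))
    (K : Knot) (β : BraidGroup n) (h : braidClosure β = K.1) :
    |I K - (Multiplicative.toAdd (lk β) : ℤ)| ≤ (closureDiagram (n := n) []).seifertCount := by
  obtain ⟨w, rfl⟩ := exists_braidOfWord β
  obtain ⟨h₁, h₂⟩ := hI K (closureDiagram w) ((braidClosure_braidOfWord w).symm.trans h)
  rw [writhe_closureDiagram, seifertCount_closureDiagram] at h₁ h₂
  rw [lk_braidOfWord, abs_le]
  constructor <;> linarith

theorem mainTheorem2 (n : ℕ) (I : Knot → ℝ)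
    (hI : ∀ (K : Knot) (D : LinkDiagram), D.IsDiagramOf K.1 →
      1 + (D.writhe : ℝ) - (D.seifertCount : ℝ) ≤ I K ∧
        I K ≤ -1 + (D.writhe : ℝ) + (D.seifertCount : ℝ))
    (α : BraidGroup n → BraidGroup n) (hα : ∀ β, IsCompletingBraid β (α β))
    (hquasi : IsQuasimorphism (inducedFunction I α hα)) :
    ∀ β : BraidGroup n,
      Tendsto (fun k : ℕ => inducedFunction I α hα (β ^ k) / (k : ℝ)) atTop
        (𝓝 (homogenization (inducedFunction I α hα) β)) ∧
      homogenization (inducedFunction I α hα) β = ((Multiplicative.toAdd (lk β) : ℤ) : ℝ) := by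
  intro β
  suffices h : Tendsto (fun k : ℕ => inducedFunction I α hα (β ^ k) / (k : ℝ)) atTop
      (𝓝 ((Multiplicative.toAdd (lk β) : ℤ) : ℝ)) from
    ⟨tendsto_nhds_limUnder ⟨_, h⟩, h.limUnder_eq⟩
  obtain ⟨C, -, hC⟩ := hquasi
  obtain ⟨v, rfl⟩ := exists_braidOfWord β
  -- Positive because the permutation group is finite; all powers with exponent divisible by `m` act
  -- trivially on colourings.
  set m := orderOf (wordPerm n v)
  have hm (q : ℕ) : wordPerm n (List.replicate (m * q) v).flatten = 1 := by
    rw [wordPerm_flatten_replicate, pow_mul, pow_orderOf_eq_one, one_pow]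
  set o : ℝ := ((closureDiagram (n := n) []).seifertCount : ℝ)
  refine tendsto_div_of_close_on_multiples (m := m)
    -- The first `o` is the error for `α β * β`; the bracket bounds `lk (α β)`, since the closure of
    -- `α β` is the unknot.
    (B := o + (|I ⟨unlink 1, isKnot_unlink_one⟩| + o)) (C := C) (orderOf_pos _)
    (fun k l => by rw [pow_add]; exact hC _ _) fun q => ?_
  set β := braidOfWord v ^ (m * q) with hβ
  have hcl : braidClosure (α β) = unlink 1 := by
    have h := hα β
    -- Keeps the rewriting of `β` as a word from reaching inside the completing braid.
    generalize α β = γ at h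
    rw [hβ, ← braidOfWord_flatten_replicate] at h
    exact h.braidClosure_eq_unlink_one (hm q)
  have h₁ := abs_sub_lk_le hI ⟨unlink 1, isKnot_unlink_one⟩ (α β) hcl
  have h₂ := abs_sub_lk_le hI ⟨_, (hα β).isKnot⟩ (α β * β) rfl
  have h₃ : ((Multiplicative.toAdd (lk (α β * β)) : ℤ) : ℝ) =
      (Multiplicative.toAdd (lk (α β)) : ℤ) +
        (m * q : ℕ) * (Multiplicative.toAdd (lk (braidOfWord v)) : ℤ) := by
    rw [map_mul, toAdd_mul, hβ, map_pow, toAdd_pow]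
    push_cast
    simp
  rw [h₃] at h₂
  have h₄ := neg_abs_le (I ⟨unlink 1, isKnot_unlink_one⟩)
  have h₅ := le_abs_self (I ⟨unlink 1, isKnot_unlink_one⟩)
  change |I ⟨_, (hα β).isKnot⟩ - _| ≤ _
  rw [abs_le] at *
  constructor <;> linarith
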